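/- Let $k$ be a field of characteristic $2$. Throughout, a function $t:\mathbb N\to\mathbb N$ is *p-bounded* if $t(n)\le n^c+c$ for some constant $c$ and all $n$, and a *family* is a sequence $(f_n)_{n\in\mathbb N}$ of polynomials $f_n\in k[X_1,\dots,X_{v(n)}]$. An *arithmetic circuit* is a finite directed acyclic graph whose vertices (*gates*) have in-degree $0$ or $2$ (parallel arrows are allowed), with exactly one vertex of out-degree $0$, the *output*; gates of in-degree $0$ are labelled by a constant of $k$ or a variable, gates of in-degree $2$ by $+$ or $\times$. Its *size* is its number of gates, inputs included. It computes a polynomial at its output in the natural way. The *sub-circuit associated to* a gate $\beta$ consists of all gates from which there is a directed path to $\beta$ (including $\beta$). A circuit is *weakly skew* if every multiplication gate $\alpha$ has an argument $\beta$ such that the arrow from $\beta$ to $\alpha$ is the only connection between the sub-circuit associated to $\beta$ and the rest of the circuit. * $\mathrm{VP}$ is the class of families with $v(n)$ and $\deg f_n$ p-bounded that are computed by arithmetic circuits of p-bounded size. * $\mathrm{VP}_{ws}$ is the class of families with $v(n)$ p-bounded that are computed by weakly skew circuits of p-bounded size. * $\mathrm{VNP}$ is the class of families $(f_n)$ for which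 there are $m:\mathbb N\to\mathbb N$ and a family $(g_n)\in\mathrm{VP}$, $g_n\in k[X_1,\dots,X_{v(n)+m(n)}]$, with $f_n(X_1,\dots,X_{v(n)})=\sum_{e\in\{0,1\}^{m(n)}}g_n(X_1,\dots,X_{v(n)},e_1,\dots,e_{m(n)})$ for all $n$. Also, $\mathrm{VNP}^2=\{(f_n^2):(f_n)\in\mathrm{VNP}\}$. * A polynomial $f$ is a *projection* of $g$ if $f$ is obtained from $g$ by substituting for each variable of $g$ a constant of $k$ or a variable of $f$. A family $(f_n)$ is a *p-projection* of $(g_n)$ if there is a p-bounded $t$ such that $f_n$ is a projection of $g_{t(n)}$ for all sufficiently large $n$. A family is *$\mathrm{VNP}$-complete* if it is in $\mathrm{VNP}$ and every family in $\mathrm{VNP}$ is a p-projection of it. The *partial permanent family* is $\mathrm{PER}^*_n=\sum_{\pi}\prod_{i\in\mathrm{def}(\pi)}X_{i\pi(i)}$, where the $X_{ij}$ ($1\le i,j\le n$) are indeterminates and $\pi$ ranges over the injective partial maps from $[n]=\{1,\dots,n\}$ to $[n]$, with domain $\mathrm{def}(\pi)$. If $(\mathrm{PER}^*_n)$ is $\mathrm{VNP}$-complete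 over $k$, then $\mathrm{VNP}^2\subseteq\mathrm{VP}_{ws}$: for every $(f_n)\in\mathrm{VNP}$, the family $(f_n^2)$ belongs to $\mathrm{VP}_{ws}$. -/

import Mathlib

namespace AlgComplexity

universe u

/-! ### Arithmetic circuits -/

/-- The label of a vertex of a circuit with constants in `k`, variables `x_i` (`i : ι`) and vertex
set `V`: an input, or a computation gate together with its two arguments (which may coincide, in
which case there are two parallel arrows). -/
inductive Gate (k : Type u) (ι : Type) (V : Type) : Type u
  | const (c : k) : Gate k ι V
  | var (i : ι) : Gate k ι V
  | add (β γ : V) : Gate k ι V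
  | mul (β γ : V) : Gate k ι V

/-- The set of arguments of a gate. -/
def Gate.args {k : Type u} {ι V : Type} : Gate k ι V → Set V
  | .const _ => ∅
  | .var _ => ∅
  | .add β γ => {β, γ}
  | .mul β γ => {β, γ}

/-- An arithmetic circuit: a finite directed acyclic graph whose vertices have in-degree `0` or `2`
and which has exactly one vertex of out-degree `0`, the output.  (On a finite vertex set,
well-foundedness of the arrow relation is the absence of directed cycles.) -/
structure Circuit (k : Type u) (ι : Type) where
  V : Type
  fintypeV : Fintype V
  gate : V → Gate k ι V
  acyclic : WellFounded (fun β α : V => β ∈ (gate α).args)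
  output : V
  outDegree_eq_zero_iff : ∀ α : V, (∀ γ : V, α ∉ (gate γ).args) ↔ α = output

namespace Circuit

variable {k : Type u} {ι : Type}

attribute [instance] Circuit.fintypeV

/-- There is an arrow from `β` to `α`. -/
def Arrow (C : Circuit k ι) (β α : C.V) : Prop := β ∈ (C.gate α).args

/-- The (fat) size of a circuit: its number of gates, inputs included. -/
def size (C : Circuit k ι) : ℕ := Fintype.card C.V

/-- `C.InSub β δ`: the gate `δ` belongs to the sub-circuit associated to `β`, i.e. there is a
directed path (possibly of length `0`) from `δ` to `β`. -/
def InSub (C : Circuit k ι) (β δ : C.V) : Prop := Relation.ReflTransGen C.Arrow δ β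

/-- Every arrow that leaves the sub-circuit associated to `β` goes from `β` to `α`.  (No arrow
enters a sub-circuit from outside.) -/
def ClosedFor (C : Circuit k ι) (α β : C.V) : Prop :=
  ∀ δ ε : C.V, C.InSub β δ → C.Arrow δ ε → C.InSub β ε ∨ (δ = β ∧ ε = α)

/-- A circuit is weakly skew if for every multiplication gate `α`, the sub-circuit associated to one
of its arguments is connected to the rest of the circuit only by the single arrow from this argument
to `α`.  The condition `β ≠ γ` expresses that this arrow is not doubled. -/
def IsWeaklySkew (C : Circuit k ι) : Prop :=
  ∀ α β γ : C.V, C.gate α = Gate.mul β γ → β ≠ γ ∧ (C.ClosedFor α β ∨ C.ClosedFor α γ)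

/-- One step of the evaluation of a circuit. -/
noncomputable def evalStep [CommSemiring k] {V : Type} (g : Gate k ι V)
    (val : ∀ β : V, β ∈ g.args → MvPolynomial ι k) : MvPolynomial ι k :=
  match g, val with
  | .const c, _ => MvPolynomial.C c
  | .var i, _ => MvPolynomial.X i
  | .add β γ, val => val β (Or.inl rfl) + val γ (Or.inr rfl)
  | .mul β γ, val => val β (Or.inl rfl) * val γ (Or.inr rfl)

/-- The polynomial computed at a gate. -/
noncomputable def value [CommSemiring k] (C : Circuit k ι) : C.V → MvPolynomial ι k :=
  C.acyclic.fix (fun α val => evalStep (C.gate α) val)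

theorem value_eq [CommSemiring k] (C : Circuit k ι) (α : C.V) :
    C.value α = match C.gate α with
      | .const c => MvPolynomial.C c
      | .var i => MvPolynomial.X i
      | .add β γ => C.value β + C.value γ
      | .mul β γ => C.value β * C.value γ := by
  have h : C.value α = evalStep (C.gate α) (fun β _ => C.value β) :=
    C.acyclic.fix_eq _ α
  rw [h]
  cases C.gate α <;> rfl

/-- The circuit computes the polynomial `f`. -/
def Computes [CommSemiring k] (C : Circuit k ι) (f : MvPolynomial ι k) : Prop :=
  C.value C.output = f

end Circuit

/-! ### Families of polynomials and complexity classes -/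

/-- A function `ℕ → ℕ` is p-bounded if it is bounded by a polynomial. -/
def PBounded (t : ℕ → ℕ) : Prop := ∃ c : ℕ, ∀ n : ℕ, t n ≤ n ^ c + c

/-- A sequence of polynomials over `k`, the `n`-th one in `numVars n` variables. -/
structure PolyFamily (k : Type u) [CommSemiring k] where
  numVars : ℕ → ℕ
  poly : ∀ n : ℕ, MvPolynomial (Fin (numVars n)) k

/-- The class VP: the families whose number of variables and degree are p-bounded and which have
arithmetic circuits of p-bounded size. -/
def VP (k : Type u) [CommSemiring k] : Set (PolyFamily k) :=
  {f | PBounded f.numVars ∧ PBounded (fun n => (f.poly n).totalDegree) ∧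
    ∃ s : ℕ → ℕ, PBounded s ∧
      ∀ n, ∃ C : Circuit k (Fin (f.numVars n)), C.size ≤ s n ∧ C.Computes (f.poly n)}

/-- The class VP_ws: the families (with a p-bounded number of variables) which have weakly skew
circuits of p-bounded size. -/
def VPws (k : Type u) [CommSemiring k] : Set (PolyFamily k) :=
  {f | PBounded f.numVars ∧
    ∃ s : ℕ → ℕ, PBounded s ∧
      ∀ n, ∃ C : Circuit k (Fin (f.numVars n)),
        C.IsWeaklySkew ∧ C.size ≤ s n ∧ C.Computes (f.poly n)}

/-- The sum `∑_{e ∈ {0,1}^m} g(X_1, …, X_v, e_1, …, e_m)`. -/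
noncomputable def boolSum {k : Type u} [CommSemiring k] {v m : ℕ}
    (g : MvPolynomial (Fin (v + m)) k) : MvPolynomial (Fin v) k :=
  ∑ e : Fin m → Bool,
    MvPolynomial.aeval
      (Fin.append (fun i : Fin v => (MvPolynomial.X i : MvPolynomial (Fin v) k))
        (fun j : Fin m => if e j then 1 else 0)) g

/-- The class VNP: the families `(f_n)` for which there is a family `(g_n)` in VP with
`f_n(X) = ∑_{e ∈ {0,1}^{m(n)}} g_n(X, e)`. -/
def VNP (k : Type u) [CommSemiring k] : Set (PolyFamily k) :=
  {f | ∃ (m : ℕ → ℕ) (g : ∀ n, MvPolynomial (Fin (f.numVars n + m n)) k),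
    (⟨fun n => f.numVars n + m n, g⟩ : PolyFamily k) ∈ VP k ∧
      ∀ n, f.poly n = boolSum (g n)}

/-- `f` is a projection of `g`: it is obtained from `g` by substituting a constant or a variable for
every variable. -/
def IsProjection {k : Type u} [CommSemiring k] {σ τ : Type}
    (f : MvPolynomial σ k) (g : MvPolynomial τ k) : Prop :=
  ∃ a : τ → k ⊕ σ,
    f = MvPolynomial.aeval
      (fun j => Sum.elim (fun c => (MvPolynomial.C c : MvPolynomial σ k)) MvPolynomial.X (a j)) g

/-- `(f_n)` is a p-projection of `(g_n)`: for some p-bounded `t`, the polynomial `f_n` is a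
projection of `g_{t(n)}` for all large enough `n`. -/
def IsPProjection {k : Type u} [CommSemiring k] (f g : PolyFamily k) : Prop :=
  ∃ t : ℕ → ℕ, PBounded t ∧ ∃ n₀ : ℕ, ∀ n ≥ n₀, IsProjection (f.poly n) (g.poly (t n))

/-- VNP-completeness, with respect to p-projections. -/
def IsVNPComplete {k : Type u} [CommSemiring k] (f : PolyFamily k) : Prop :=
  f ∈ VNP k ∧ ∀ g ∈ VNP k, IsPProjection g f

/-- The family `(f_n ^ 2)`. -/
noncomputable def PolyFamily.sq {k : Type u} [CommSemiring k] (f : PolyFamily k) : PolyFamily k :=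
  ⟨f.numVars, fun n => f.poly n ^ 2⟩

/-- The class VNP² of squares of VNP families. -/
def VNPSq (k : Type u) [CommSemiring k] : Set (PolyFamily k) :=
  PolyFamily.sq '' VNP k

/-! ### The partial permanent -/

/-- A partial map from `[n]` to `[n]` (`none` = undefined) which is injective on its domain. -/
def PartialInjective {n : ℕ} (π : Fin n → Option (Fin n)) : Prop :=
  ∀ i j a, π i = some a → π j = some a → i = j

open Classical in
/-- The partial permanent `∑_π ∏_{i ∈ def π} A_{i π(i)}`, where `π` ranges over the injective partial
maps from `[n]` to `[n]`. -/
noncomputable def partialPermanent {R : Type u} [CommSemiring R] {n : ℕ}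
    (A : Matrix (Fin n) (Fin n) R) : R :=
  ∑ π : Fin n → Option (Fin n) with PartialInjective π,
    ∏ i, (π i).elim 1 (fun j => A i j)

/-- The family `(PER*_n)`: the partial permanents of the generic `n × n` matrices, whose `(i,j)` entry
is the indeterminate with number `finProdFinEquiv (i, j)` among `n * n`. -/
noncomputable def partialPermanentFamily (k : Type u) [CommSemiring k] : PolyFamily k where
  numVars n := n * n
  poly n := partialPermanent (Matrix.of fun i j : Fin n => MvPolynomial.X (finProdFinEquiv (i, j)))

end AlgComplexity

/-! ### Skew straight-line programs and weakly skew circuits -/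

namespace AlgComplexity

open MvPolynomial

variable {k : Type*} {ι : Type}

/-! In characteristic 2 the square of a partial permanent is a determinant (`partialPermanent_sq`).
The determinant of the symmetric matrix with blocks `1, A, Aᵀ, 1` has no signs, and the terms of `σ`
and `σ⁻¹` agree, so only involutions survive. The identity blocks force such an involution, if its
term is nonzero, to fix a vertex or exchange it with one on the other side. It is thus a partial
matching `π`, and its term is the square of the term of `π`. Since squaring is additive, these terms
sum to the square of the partial permanent.

Determinants of matrices of constants and variables have short programs in which every product has
an atomic factor (`exists_skewList_det`). These come from a division-free recursion for `det (1 + X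
M)` over leading corners, in the style of Samuelson and Berkowitz. Giving each product its own copy
of the atomic factor makes the circuit weakly skew (`SkewInstr.exists_circuit`).

By completeness `f n` is a projection of a partial permanent of polynomial size for large `n`.
Substituting into the block matrix keeps its entries atomic, so `f n ^ 2` is such a determinant. -/

/-- The restriction of a gate to a set of vertices containing its arguments. -/
def Gate.restrict {V : Type} {P : V → Prop} (g : Gate k ι V) (h : ∀ β ∈ g.args, P β) :
    Gate k ι {β // P β} :=
  match g, h with
  | .const c, _ => .const c
  | .var i, _ => .var i
  | .add β γ, h => .add ⟨β, h β (Or.inl rfl)⟩ ⟨γ, h γ (Or.inr rfl)⟩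
  | .mul β γ, h => .mul ⟨β, h β (Or.inl rfl)⟩ ⟨γ, h γ (Or.inr rfl)⟩

theorem Gate.mem_args_restrict {V : Type} {P : V → Prop} (g : Gate k ι V)
    (h : ∀ β ∈ g.args, P β) (β : {β // P β}) : β ∈ (g.restrict h).args ↔ β.1 ∈ g.args := by
  cases g <;> simp [Gate.restrict, Gate.args, Subtype.ext_iff]

theorem Gate.eq_mul_of_restrict {V : Type} {P : V → Prop} {g : Gate k ι V}
    {h : ∀ β ∈ g.args, P β} {β γ : {β // P β}} (e : g.restrict h = .mul β γ) :
    g = .mul β.1 γ.1 := by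
  cases g <;> simp_all [Gate.restrict, Subtype.ext_iff]

/-- The value of a gate in terms of the values of its arguments. -/
noncomputable def Gate.apply [CommSemiring k] {V : Type} (g : Gate k ι V)
    (val : V → MvPolynomial ι k) : MvPolynomial ι k :=
  match g with
  | .const c => C c
  | .var i => X i
  | .add β γ => val β + val γ
  | .mul β γ => val β * val γ

/-- The part of a gate-labelled acyclic graph from which a given vertex is reachable is a circuit
with that vertex as its output. -/
noncomputable def Circuit.ofReachable {V : Type} [Fintype V] (gate : V → Gate k ι V)
    (acyclic : WellFounded (fun β α : V => β ∈ (gate α).args)) (out : V) : Circuit k ι where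
  V := {δ // Relation.ReflTransGen (fun β α : V => β ∈ (gate α).args) δ out}
  fintypeV := Fintype.ofFinite _
  gate α := (gate α.1).restrict fun _ hβ => Relation.ReflTransGen.head hβ α.2
  acyclic := by
    refine Subrelation.wf ?_ (InvImage.wf Subtype.val acyclic)
    intro β α h
    exact (Gate.mem_args_restrict _ _ _).1 h
  output := ⟨out, .refl⟩
  outDegree_eq_zero_iff := by
    intro α
    simp only [Gate.mem_args_restrict]
    constructor
    · intro h
      rcases Relation.ReflTransGen.cases_head α.2 with h' | ⟨c, h', hc⟩
      · exact Subtype.ext h'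
      · exact absurd h' (h ⟨c, hc⟩)
    -- An arrow from the output to a vertex that reaches the output would close a cycle.
    · rintro rfl γ hγ
      have := acyclic.transGen
      exact this.irrefl.irrefl out (Relation.TransGen.head' hγ γ.2)

theorem Circuit.size_ofReachable_le {V : Type} [Fintype V] (gate : V → Gate k ι V)
    (acyclic : WellFounded (fun β α : V => β ∈ (gate α).args)) (out : V) :
    (Circuit.ofReachable gate acyclic out).size ≤ Fintype.card V := by
  unfold Circuit.size
  rw [← Nat.card_eq_fintype_card, ← Nat.card_eq_fintype_card]
  exact Finite.card_subtype_le _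

theorem Circuit.value_ofReachable [CommSemiring k] {V : Type} [Fintype V]
    (gate : V → Gate k ι V) (acyclic : WellFounded (fun β α : V => β ∈ (gate α).args)) (out : V)
    (val : V → MvPolynomial ι k) (hval : ∀ α, val α = (gate α).apply val)
    (α : (Circuit.ofReachable gate acyclic out).V) :
    (Circuit.ofReachable gate acyclic out).value α = val α.1 := by
  induction α using (Circuit.ofReachable gate acyclic out).acyclic.induction with
  | _ α ih =>
    rw [Circuit.value_eq, hval]
    have hg : (Circuit.ofReachable gate acyclic out).gate α = (gate α.1).restrict
        fun _ hβ => Relation.ReflTransGen.head hβ α.2 := rfl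
    have ih' : ∀ β, β ∈ ((Circuit.ofReachable gate acyclic out).gate α).args →
      (Circuit.ofReachable gate acyclic out).value β = val β.1 := ih
    revert ih'
    rw [hg]
    generalize (fun β (hβ : β ∈ (gate α.1).args) => Relation.ReflTransGen.head
      (r := fun β α : V => β ∈ (gate α).args) hβ α.2) = H
    revert H
    generalize gate α.1 = g
    intro H ih'
    cases g with
    | const c => rfl
    | var i => rfl
    | add β γ => exact congrArg₂ (· + ·) (ih' _ (Or.inl rfl)) (ih' _ (Or.inr rfl))
    | mul β γ => exact congrArg₂ (· * ·) (ih' _ (Or.inl rfl)) (ih' _ (Or.inr rfl))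

/-- An input gate is its whole sub-circuit, so if it feeds only `α`, its one arrow is the only
connection to the rest. -/
theorem Circuit.isWeaklySkew_ofReachable {V : Type} [Fintype V] (gate : V → Gate k ι V)
    (acyclic : WellFounded (fun β α : V => β ∈ (gate α).args)) (out : V)
    (hskew : ∀ α β γ, gate α = .mul β γ →
      β ≠ γ ∧ (gate β).args = ∅ ∧ ∀ ε, β ∈ (gate ε).args → ε = α) :
    (Circuit.ofReachable gate acyclic out).IsWeaklySkew := by
  intro α β γ h
  obtain ⟨hne, hβ, hα⟩ := hskew _ _ _ (Gate.eq_mul_of_restrict h)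
  refine ⟨fun e => hne (congrArg Subtype.val e), Or.inl ?_⟩
  intro δ ε hδ hε
  have hδβ : δ = β := by
    rcases Relation.ReflTransGen.cases_tail hδ with h' | ⟨c, -, hc⟩
    · exact h'.symm
    · have := (Gate.mem_args_restrict _ _ _).1 hc
      rw [hβ] at this
      exact this.elim
  subst hδβ
  exact Or.inr ⟨rfl, Subtype.ext (hα _ ((Gate.mem_args_restrict _ _ _).1 hε))⟩

/-- The polynomial given by a constant or a variable. -/
noncomputable def atom [CommSemiring k] (w : k ⊕ ι) : MvPolynomial ι k := Sum.elim C X w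

/-- A skew straight-line program: every entry of the list is a constant, a sum of two later entries,
or the product of a later entry with a constant or a variable. -/
inductive SkewList [CommSemiring k] : List (MvPolynomial ι k) → Prop
  | nil : SkewList []
  | const (c : k) {L} : SkewList L → SkewList (C c :: L)
  | add {p q L} : p ∈ L → q ∈ L → SkewList L → SkewList ((p + q) :: L)
  | mul (w : k ⊕ ι) {p L} : p ∈ L → SkewList L → SkewList ((atom w * p) :: L)

/-- An instruction of a skew straight-line program. -/
inductive SkewInstr (k : Type*) (ι : Type) (M : Type) : Type _
  | const (c : k)
  | add (i j : M)
  | mul (w : k ⊕ ι) (j : M)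

namespace SkewInstr

variable {M : Type}

/-- The arguments of an instruction. -/
def args : SkewInstr k ι M → Set M
  | .const _ => ∅
  | .add i j => {i, j}
  | .mul _ j => {j}

/-- The value of an instruction in terms of the values of its arguments. -/
noncomputable def apply [CommSemiring k] (val : M → MvPolynomial ι k) :
    SkewInstr k ι M → MvPolynomial ι k
  | .const c => C c
  | .add i j => val i + val j
  | .mul w j => atom w * val j

/-- Relabelling the arguments of an instruction. -/
def map {N : Type} (f : M → N) : SkewInstr k ι M → SkewInstr k ι N
  | .const c => .const c
  | .add i j => .add (f i) (f j)
  | .mul w j => .mul w (f j)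

/-- The input gate belonging to a constant or a variable. -/
def inputGate {V : Type} : k ⊕ ι → Gate k ι V
  | .inl c => .const c
  | .inr i => .var i

/-- The gates of the skew circuit of a program: `(i, true)` computes the value of the `i`-th
instruction, `(i, false)` is the scalar factor of this instruction. -/
def gate [Zero k] (ins : M → SkewInstr k ι M) : M × Bool → Gate k ι (M × Bool)
  | (i, true) => match ins i with
    | .const c => .const c
    | .add j l => .add (j, true) (l, true)
    | .mul _ j => .mul (i, false) (j, true)
  | (i, false) => match ins i with
    | .mul w _ => inputGate w
    -- Filler: no arrow leaves this vertex, so `Circuit.ofReachable` drops it.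
    | _ => .const 0

theorem args_gate_false [Zero k] (ins : M → SkewInstr k ι M) (i : M) :
    (gate ins (i, false)).args = ∅ := by
  rcases hi : ins i with c | ⟨j, l⟩ | ⟨w | w, j⟩ <;> simp [gate, hi, inputGate, Gate.args]

theorem mem_args_gate [Zero k] (ins : M → SkewInstr k ι M) {β : M × Bool} {i : M}
    (h : β ∈ (gate ins (i, true)).args) :
    β = (i, false) ∨ ∃ j ∈ (ins i).args, β = (j, true) := by
  unfold gate at h
  rcases hi : ins i with c | ⟨j, l⟩ | ⟨w, j⟩ <;>
    simp_all [Gate.args, SkewInstr.args]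

theorem exists_circuit [CommSemiring k] [Fintype M] (ins : M → SkewInstr k ι M)
    (rank : M → ℕ) (hrank : ∀ i, ∀ j ∈ (ins i).args, rank j < rank i)
    (val : M → MvPolynomial ι k) (hval : ∀ i, val i = (ins i).apply val) (i : M) :
    ∃ C : Circuit k ι, C.IsWeaklySkew ∧ C.size ≤ 2 * Fintype.card M ∧ C.Computes (val i) := by
  have hwf : WellFounded (fun β α : M × Bool => β ∈ (gate ins α).args) := by
    refine Subrelation.wf ?_ (InvImage.wf
      (fun x : M × Bool => if x.2 then rank x.1 + 1 else 0) Nat.lt_wfRel.wf)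
    rintro β ⟨i, _ | _⟩ h
    · rw [args_gate_false] at h
      exact h.elim
    · rcases mem_args_gate ins h with rfl | ⟨j, hj, rfl⟩
      · simp [InvImage, WellFoundedRelation.rel]
      · simpa [InvImage, WellFoundedRelation.rel] using hrank i j hj
  refine ⟨Circuit.ofReachable (gate ins) hwf (i, true), ?_, ?_, ?_⟩
  · apply Circuit.isWeaklySkew_ofReachable
    rintro ⟨i, _ | _⟩ β γ h
    · have := args_gate_false ins i
      rw [h] at this
      exact absurd this (Set.insert_nonempty _ _).ne_empty
    · have hβ : β = (i, false) ∧ γ.2 = true := by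
        unfold gate at h
        rcases hi : ins i with c | ⟨j, l⟩ | ⟨w, j⟩ <;> simp [hi] at h
        exact ⟨h.1.symm, by rw [← h.2]⟩
      obtain ⟨rfl, hγ⟩ := hβ
      refine ⟨?_, args_gate_false ins i, ?_⟩
      · rintro rfl
        simp at hγ
      · rintro ⟨j, _ | _⟩ hj
        · rw [args_gate_false] at hj
          exact hj.elim
        · rcases mem_args_gate ins hj with h' | ⟨l, -, h'⟩ <;> simp_all
  · refine (Circuit.size_ofReachable_le _ _ _).trans ?_
    simp [mul_comm]
  · let v : M × Bool → MvPolynomial ι k := fun x =>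
      if x.2 then val x.1 else (gate ins x).apply (fun _ => 0)
    have := Circuit.value_ofReachable (gate ins) hwf (i, true) v (by
      rintro ⟨i, _ | _⟩
      · simp only [v, gate]
        rcases ins i with c | ⟨j, l⟩ | ⟨w | w, j⟩ <;> rfl
      · have h := hval i
        rcases hi : ins i with c | ⟨j, l⟩ | ⟨w | w, j⟩ <;> rw [hi] at h <;>
          simp [v, gate, hi, Gate.apply, h, SkewInstr.apply, atom, inputGate]) ⟨(i, true), .refl⟩
    exact this

end SkewInstr

namespace SkewList

variable [CommSemiring k] {L L' : List (MvPolynomial ι k)} {p q : MvPolynomial ι k}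

theorem exists_instr (h : SkewList L) : ∃ ins : Fin L.length → SkewInstr k ι (Fin L.length),
    ∀ i, (∀ j ∈ (ins i).args, i < j) ∧ L.get i = (ins i).apply L.get := by
  suffices ∀ i, ∃ s : SkewInstr k ι (Fin L.length),
      (∀ j ∈ s.args, i < j) ∧ L.get i = s.apply L.get from ⟨_, fun i => (this i).choose_spec⟩
  have step : ∀ (f : MvPolynomial ι k) (L : List (MvPolynomial ι k)),
      (∀ i, ∃ s : SkewInstr k ι (Fin L.length), (∀ j ∈ s.args, i < j) ∧ L.get i = s.apply L.get) →
      (∃ s : SkewInstr k ι (Fin L.length), f = s.apply L.get) →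
      ∀ i, ∃ s : SkewInstr k ι (Fin (f :: L).length),
        (∀ j ∈ s.args, i < j) ∧ (f :: L).get i = s.apply (f :: L).get := by
    intro f L ih hf i
    have aux : ∀ s : SkewInstr k ι (Fin L.length),
        (∀ j ∈ (s.map Fin.succ : SkewInstr k ι (Fin (f :: L).length)).args,
          ∃ j' ∈ s.args, j = Fin.succ j') ∧
        (s.map Fin.succ).apply (f :: L).get = s.apply L.get := by
      rintro (c | ⟨j, l⟩ | ⟨w, j⟩) <;> simp [SkewInstr.map, SkewInstr.args, SkewInstr.apply]
    induction i using Fin.cases with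
    | zero =>
      obtain ⟨s, hs⟩ := hf
      refine ⟨s.map Fin.succ, ?_, ?_⟩
      · intro j hj
        obtain ⟨j', -, rfl⟩ := (aux s).1 j hj
        exact Fin.succ_pos _
      · rw [(aux s).2]
        exact hs
    | succ i =>
      obtain ⟨s, hs, hs'⟩ := ih i
      refine ⟨s.map Fin.succ, ?_, ?_⟩
      · intro j hj
        obtain ⟨j', hj', rfl⟩ := (aux s).1 j hj
        exact Fin.succ_lt_succ_iff.2 (hs _ hj')
      · rw [(aux s).2]
        exact hs'
  induction h with
  | nil => exact fun i => i.elim0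
  | const c _ ih => exact step _ _ ih ⟨.const c, rfl⟩
  | add hp hq _ ih =>
    obtain ⟨i, rfl⟩ := List.get_of_mem hp
    obtain ⟨j, rfl⟩ := List.get_of_mem hq
    exact step _ _ ih ⟨.add i j, rfl⟩
  | mul w hp _ ih =>
    obtain ⟨i, rfl⟩ := List.get_of_mem hp
    exact step _ _ ih ⟨.mul w i, rfl⟩

theorem exists_circuit (h : SkewList L) (hp : p ∈ L) :
    ∃ C : Circuit k ι, C.IsWeaklySkew ∧ C.size ≤ 2 * L.length ∧ C.Computes p := by
  obtain ⟨ins, hins⟩ := h.exists_instr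
  obtain ⟨i, rfl⟩ := List.get_of_mem hp
  -- Arguments stand later in the list, so the rank decreases with the index.
  simpa using SkewInstr.exists_circuit ins (fun i => L.length - i)
    (fun i j hj => by have := (hins i).1 j hj; have := i.2; have := j.2; omega) L.get
    (fun i => (hins i).2) i

theorem append (h : SkewList L) (h' : SkewList L') : SkewList (L ++ L') := by
  induction h with
  | nil => exact h'
  | const c _ ih => exact .const c ih
  | add hp hq _ ih => exact .add (List.mem_append_left _ hp) (List.mem_append_left _ hq) ih
  | mul w hp _ ih => exact .mul w (List.mem_append_left _ hp) ih

/-- No length bound: this serves the finitely many `n` about which a p-projection says nothing. -/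
theorem exists_mem (p : MvPolynomial ι k) : ∃ L, SkewList L ∧ p ∈ L := by
  induction p using MvPolynomial.induction_on with
  | C c => exact ⟨[C c], .const c .nil, by simp⟩
  | add p q hp hq =>
    obtain ⟨L, hL, hp⟩ := hp
    obtain ⟨L', hL', hq⟩ := hq
    exact ⟨_, .add (List.mem_append_left _ hp) (List.mem_append_right _ hq) (hL.append hL'),
      by simp⟩
  | mul_X p i hp =>
    obtain ⟨L, hL, hp⟩ := hp
    exact ⟨_, .mul (.inr i) hp hL, by simp [atom, mul_comm]⟩

end SkewList

end AlgComplexity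

/-! ### The square of the partial permanent as a determinant -/

namespace AlgComplexity
open Equiv Matrix

/-- In characteristic two, the determinant of a symmetric matrix is a sum over involutions. -/
theorem det_eq_sum_involutive {R m : Type*} [CommRing R] [CharP R 2] [Fintype m] [DecidableEq m]
    {S : Matrix m m R} (hS : S.IsSymm) :
    S.det = ∑ σ : Perm m with σ⁻¹ = σ, ∏ i, S i (σ i) := by
  have hdet : S.det = ∑ σ : Perm m, ∏ i, S i (σ i) := by
    rw [← Matrix.det_transpose, Matrix.det_apply]
    refine Finset.sum_congr rfl fun σ _ => ?_
    rcases Int.units_eq_one_or (Perm.sign σ) with h | h <;>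
      simp [h, Matrix.transpose_apply, Units.smul_def, CharTwo.neg_eq]
  have hinv : ∀ σ : Perm m, ∏ i, S i (σ⁻¹ i) = ∏ i, S i (σ i) := by
    intro σ
    rw [← Equiv.prod_comp σ]
    refine Finset.prod_congr rfl fun i _ => ?_
    rw [Perm.inv_eq_iff_eq.2 rfl, hS.apply]
  -- The permutations with `σ⁻¹ ≠ σ` pair off with their inverses and cancel modulo 2.
  rw [hdet, ← Finset.sum_filter_add_sum_filter_not Finset.univ (fun σ : Perm m => σ⁻¹ = σ)]
  rw [add_eq_left]
  refine Finset.sum_involution (fun σ _ => σ⁻¹) ?_ ?_ ?_ ?_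
  · intro σ _
    rw [hinv, CharTwo.add_self_eq_zero]
  · intro σ hσ _
    simpa using hσ
  · intro σ hσ
    simpa [eq_comm] using hσ
  · intro σ _
    exact inv_inv σ

section Involution

variable {n : ℕ} (π : Fin n → Option (Fin n))

open Classical in
/-- The partial inverse of an injective partial map. -/
noncomputable def partialInverse (j : Fin n) : Option (Fin n) :=
  if h : ∃ i, π i = some j then some h.choose else none

variable {π}

theorem PartialInjective.partialInverse_eq_some (hπ : PartialInjective π) {i j : Fin n} :
    partialInverse π j = some i ↔ π i = some j := by
  unfold partialInverse
  split_ifs with h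
  · rw [Option.some.injEq]
    exact ⟨fun e => e ▸ h.choose_spec, fun e => hπ _ _ _ h.choose_spec e⟩
  · simp only [false_iff]
    exact fun e => h ⟨i, e⟩

variable (π) in
/-- The map exchanging the left copy of `i` and the right copy of `π i`, for all `i` in the domain
of `π`. -/
noncomputable def swapMap : Fin n ⊕ Fin n → Fin n ⊕ Fin n
  | .inl i => (π i).elim (.inl i) .inr
  | .inr j => (partialInverse π j).elim (.inr j) .inl

theorem PartialInjective.involutive_swapMap (hπ : PartialInjective π) :
    Function.Involutive (swapMap π) := by
  rintro (i | j)
  · rcases h : π i with _ | j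
    · simp [swapMap, h]
    · simp [swapMap, h, hπ.partialInverse_eq_some.2 h]
  · rcases h : partialInverse π j with _ | i
    · simp [swapMap, h]
    · simp [swapMap, h, hπ.partialInverse_eq_some.1 h]

open Classical in
variable (π) in
/-- The involution belonging to an injective partial map. -/
noncomputable def swapPerm : Perm (Fin n ⊕ Fin n) :=
  if h : PartialInjective π then h.involutive_swapMap.toPerm else 1

theorem PartialInjective.swapPerm_apply (hπ : PartialInjective π) (x : Fin n ⊕ Fin n) :
    swapPerm π x = swapMap π x := by
  simp [swapPerm, hπ]

/-- Each matched pair `(i, j)` contributes `A i j` twice, once from the left vertex `i` and once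
from the right vertex `j`. Both halves are written as products over all pairs and compared by
exchanging the products. -/
theorem PartialInjective.prod_swapPerm {R : Type*} [CommRing R] (hπ : PartialInjective π)
    (A : Matrix (Fin n) (Fin n) R) :
    ∏ x, fromBlocks 1 A A.transpose 1 x (swapPerm π x) =
      (∏ i, (π i).elim 1 fun j => A i j) ^ 2 := by
  have h1 : ∀ i, fromBlocks 1 A A.transpose 1 (.inl i) (swapPerm π (.inl i)) =
      (π i).elim 1 fun j => A i j := by
    intro i
    rw [hπ.swapPerm_apply]
    rcases h : π i with _ | j <;> simp [swapMap, h]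
  have h2 : ∀ j, fromBlocks 1 A A.transpose 1 (.inr j) (swapPerm π (.inr j)) =
      (partialInverse π j).elim 1 fun i => A i j := by
    intro i
    rw [hπ.swapPerm_apply]
    rcases h : partialInverse π i with _ | j <;> simp [swapMap, h]
  have h3 : ∀ i, ((π i).elim 1 fun j => A i j) = ∏ j, if π i = some j then A i j else 1 := by
    intro i
    rcases h : π i with _ | j <;> simp
  have h4 : ∀ j, ((partialInverse π j).elim 1 fun i => A i j) =
      ∏ i, if π i = some j then A i j else 1 := by
    intro j
    simp only [← hπ.partialInverse_eq_some]
    rcases h : partialInverse π j with _ | i <;> simp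
  rw [Fintype.prod_sum_type, sq]
  simp only [h1, h2]
  congr 1
  simp only [h3, h4]
  exact Finset.prod_comm

end Involution

/-- In characteristic two, the square of a partial permanent is a determinant. -/
theorem partialPermanent_sq {R : Type*} [CommRing R] [CharP R 2] {n : ℕ}
    (A : Matrix (Fin n) (Fin n) R) :
    partialPermanent A ^ 2 = (fromBlocks 1 A A.transpose 1).det := by
  classical
  rw [det_eq_sum_involutive (by simp [Matrix.IsSymm, Matrix.fromBlocks_transpose]),
    partialPermanent, CharTwo.sum_sq]
  refine Finset.sum_of_injOn swapPerm ?_ ?_ ?_ ?_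
  · intro π hπ ρ hρ h
    have hπ : PartialInjective π := by simpa using hπ
    have hρ : PartialInjective ρ := by simpa using hρ
    funext i
    have := congrArg (fun σ => σ (.inl i)) h
    simp only [hπ.swapPerm_apply, hρ.swapPerm_apply, swapMap] at this
    rcases h1 : π i with _ | j <;> rcases h2 : ρ i with _ | l <;> simp_all
  · intro π hπ
    have hπ : PartialInjective π := by simpa using hπ
    simp only [Finset.coe_filter, Finset.mem_univ, true_and, Set.mem_ofPred_eq]
    rw [inv_eq_iff_mul_eq_one]
    ext x
    simp [hπ.swapPerm_apply, hπ.involutive_swapMap x]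
  · intro σ hσ hσ'
    by_contra hne
    have hσ : ∀ x, σ (σ x) = x := by
      have : σ⁻¹ = σ := by simpa using hσ
      exact fun x => (Perm.inv_eq_iff_eq.1 (congrArg (fun τ => τ x) this)).symm
    have hne : ∀ x, fromBlocks 1 A A.transpose 1 x (σ x) ≠ 0 := fun x hx =>
      hne (Finset.prod_eq_zero (Finset.mem_univ x) hx)
    let π : Fin n → Option (Fin n) := fun i => (σ (.inl i)).elim (fun _ => none) some
    have hπ_some : ∀ i j, π i = some j ↔ σ (.inl i) = .inr j := by
      intro i j
      simp only [π]
      rcases σ (.inl i) with l | l <;> simp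
    have hπ : PartialInjective π := by
      intro i j l hi hj
      rw [hπ_some] at hi hj
      exact Sum.inl_injective (σ.injective (hi.trans hj.symm))
    refine hσ' ⟨π, by simpa using hπ, ?_⟩
    ext x
    rw [hπ.swapPerm_apply]
    rcases x with i | j
    · rcases h : σ (.inl i) with l | l
      · have := hne (.inl i)
        rw [h, fromBlocks_apply₁₁, Matrix.one_apply] at this
        simp_all [swapMap, π]
      · simp [swapMap, (hπ_some _ _).2 h]
    · rcases h : σ (.inr j) with l | l
      · have : π l = some j := by rw [hπ_some, ← h, hσ]
        simp [swapMap, hπ.partialInverse_eq_some.2 this]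
      · have h1 := hne (.inr j)
        rw [h, fromBlocks_apply₂₂, Matrix.one_apply] at h1
        obtain rfl : j = l := (by simpa using h1 : _ ∧ _).1
        have h2 : partialInverse π j = none := by
          rw [Option.eq_none_iff_forall_ne_some]
          intro i hi
          rw [hπ.partialInverse_eq_some, hπ_some] at hi
          have := hσ (.inl i)
          rw [hi, h] at this
          cases this
        simp [swapMap, h2]
  · intro π hπ
    have hπ : PartialInjective π := by simpa using hπ
    rw [hπ.prod_swapPerm]
end AlgComplexity

/-! ### Bordered determinants -/

namespace AlgComplexity
open Matrix

/-- Expansion of the determinant of a bordered matrix. -/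
theorem det_fromBlocks_unit {R m : Type*} [CommRing R] [IsDomain R] [Fintype m] [DecidableEq m]
    (P : Matrix m m R) (hP : P.det ≠ 0) (c : m → R) (r : m → R) (d : R) :
    (fromBlocks P (replicateCol Unit c) (replicateRow Unit r) (of fun _ _ => d)).det =
      d * P.det - r ⬝ᵥ (P.adjugate *ᵥ c) := by
  -- Column elimination with `P * adj P = det P` in place of an inverse. Taking determinants leaves
  -- a factor `det P` on both sides, which is then cancelled.
  have key : fromBlocks P (replicateCol Unit c) (replicateRow Unit r) (of fun _ _ => d) *
      fromBlocks 1 (-replicateCol Unit (P.adjugate *ᵥ c)) 0 (of fun _ _ => P.det) =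
      fromBlocks P 0 (replicateRow Unit r)
        (of fun _ _ => d * P.det - r ⬝ᵥ (P.adjugate *ᵥ c)) := by
    rw [fromBlocks_multiply]
    congr 1
    · simp
    · ext i j
      have := congrFun (Matrix.mulVec_mulVec c P P.adjugate) i
      rw [Matrix.mul_adjugate, Matrix.smul_mulVec, Matrix.one_mulVec] at this
      simp only [Matrix.mul_neg, Matrix.add_apply, Matrix.neg_apply, Matrix.zero_apply]
      have e1 : (P * replicateCol Unit (P.adjugate *ᵥ c)) i j = (P *ᵥ (P.adjugate *ᵥ c)) i := rfl
      rw [e1, this]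
      simp [Matrix.mul_apply, mul_comm]
    · simp
    · ext i j
      have e1 : (replicateRow Unit r * replicateCol Unit (P.adjugate *ᵥ c)) i j =
        r ⬝ᵥ (P.adjugate *ᵥ c) := rfl
      simp only [Matrix.mul_neg, Matrix.add_apply, Matrix.neg_apply, e1]
      simp [Matrix.mul_apply]
      ring
  have := congrArg det key
  rw [det_mul, det_fromBlocks_zero₂₁, det_fromBlocks_zero₁₂, det_one, one_mul,
    det_unique (of fun _ _ : Unit => P.det),
    det_unique (of fun _ _ : Unit => d * P.det - r ⬝ᵥ (P.adjugate *ᵥ c)), mul_comm] at this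
  exact mul_left_cancel₀ hP this

/-! ### Division-free recursion for `det (1 + X M)` -/

section Samuelson

open Polynomial

variable {R : Type*} [CommRing R] (a : ℕ → ℕ → R) (n : ℕ)

/-- The matrix `1 + X M`, where `M` is the upper left `n × n` corner of `a`. -/
noncomputable def revMatrix : Matrix (Fin n) (Fin n) R[X] :=
  1 + (X : R[X]) • of fun i j : Fin n => C (a i j)

/-- The vector `adj(1 + X M) v`, where `v` is the upper part of the `n`-th column of `a`. -/
noncomputable def revVec : Fin n → R[X] :=
  (revMatrix a n).adjugate *ᵥ fun i => C (a i n)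

theorem coeff_zero_det_revMatrix : (revMatrix a n).det.coeff 0 = 1 := by
  rw [coeff_zero_eq_eval_zero, ← coe_evalRingHom, RingHom.map_det]
  convert det_one (R := R) (n := Fin n)
  ext i j
  rcases eq_or_ne i j with hij | hij <;> simp [revMatrix, hij, one_apply]

/-- Modulo 2, `1 + X M` is `1 - X M`, whose determinant is the reversed characteristic polynomial.
Its coefficient at `n` is therefore `det M` up to a sign. -/
theorem coeff_det_revMatrix [CharP R 2] :
    (revMatrix a n).det.coeff n = (of fun i j : Fin n => a i j).det := by
  nontriviality R
  have : (revMatrix a n).det = (of fun i j : Fin n => a i j).charpolyRev := by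
    unfold charpolyRev revMatrix
    congr 1
    ext1 i j
    exact (CharTwo.sub_eq_add _ _).symm
  rw [this, ← reverse_charpoly, coeff_reverse, charpoly_natDegree_eq_dim, Fintype.card_fin,
    revAt_le le_rfl, Nat.sub_self, det_eq_sign_charpoly_coeff, CharTwo.neg_eq, one_pow, one_mul]

/-- Border expansion, where the new row and column each carry a factor `X`. The previous determinant
may be cancelled because its constant coefficient is 1. -/
theorem det_revMatrix_succ [CharP R 2] [IsDomain R] :
    (revMatrix a (n + 1)).det = (revMatrix a n).det + X * (C (a n n) * (revMatrix a n).det) +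
      X * (X * ∑ i : Fin n, C (a n i) * revVec a n i) := by
  have hne : (revMatrix a n).det ≠ 0 := by
    intro h
    have := coeff_zero_det_revMatrix a n
    simp [h] at this
  let e : Fin n ⊕ Unit ≃ Fin (n + 1) :=
    (Equiv.sumCongr (Equiv.refl _) (Equiv.ofUnique Unit (Fin 1))).trans finSumFinEquiv
  have h := det_fromBlocks_unit (revMatrix a n) hne (fun i => X * C (a i n))
    (fun i => X * C (a n i)) (1 + X * C (a n n))
  have h' : fromBlocks (revMatrix a n) (replicateCol Unit fun i : Fin n => X * C (a i n))
      (replicateRow Unit fun i : Fin n => X * C (a n i)) (of fun _ _ => 1 + X * C (a n n)) =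
      (revMatrix a (n + 1)).submatrix e e := by
    ext1 i j
    rcases i with i | i <;> rcases j with j | j <;>
      simp [e, revMatrix, Matrix.one_apply, Fin.ext_iff, finSumFinEquiv]
    · exact fun h => absurd h i.2.ne
    · exact fun h => absurd h.symm j.2.ne
  rw [h', det_submatrix_equiv_self] at h
  rw [h, CharTwo.sub_eq_add]
  have h2 : (fun i : Fin n => X * C (a i n)) = (X : R[X]) • fun i : Fin n => C (a i n) := rfl
  have h3 : (fun i : Fin n => X * C (a n i)) = (X : R[X]) • fun i : Fin n => C (a n i) := rfl
  rw [h2, h3, mulVec_smul, smul_dotProduct, dotProduct_smul]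
  simp only [smul_eq_mul, dotProduct, revVec]
  ring

/-- This is `(1 + X M) adj(1 + X M) v = det(1 + X M) v` solved for the summand without `X`. It
yields the coefficients of the vector degree by degree, multiplying only by matrix entries. -/
theorem revVec_eq [CharP R 2] (i : Fin n) :
    revVec a n i = C (a i n) * (revMatrix a n).det + X * ∑ j : Fin n, C (a i j) * revVec a n j := by
  have h := congrFun (mulVec_mulVec (fun i : Fin n => C (a i n)) (revMatrix a n)
    (revMatrix a n).adjugate) i
  rw [mul_adjugate, smul_mulVec, one_mulVec] at h
  change (revMatrix a n *ᵥ revVec a n) i = _ at h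
  rw [revMatrix, add_mulVec, one_mulVec, smul_mulVec] at h
  rw [← sub_eq_iff_eq_add, CharTwo.sub_eq_add]
  rw [mul_comm (C _)]
  exact h

end Samuelson

/-! ### Cost accounting for skew programs -/

section Reach

open MvPolynomial

variable {K : Type*} {ι : Type}

/-- Every skew program computing the polynomials in `A` can be extended by at most `c` instructions
to one computing the polynomials in `B`. -/
def Reach [CommSemiring K] (c : ℕ) (A B : Set (MvPolynomial ι K)) : Prop :=
  ∀ L, SkewList L → (∀ p ∈ A, p ∈ L) →
    ∃ L', SkewList L' ∧ L ⊆ L' ∧ (∀ p ∈ B, p ∈ L') ∧ L'.length ≤ L.length + c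

namespace Reach

variable [CommSemiring K] {A B D : Set (MvPolynomial ι K)} {c d : ℕ} {p q : MvPolynomial ι K}

theorem of_subset (h : B ⊆ A) : Reach 0 A B :=
  fun L hL hA => ⟨L, hL, fun _ => id, fun p hp => hA p (h hp), le_rfl⟩

theorem mono (h : Reach c A B) (hcd : c ≤ d) : Reach d A B := fun L hL hA =>
  let ⟨L', h1, h2, h3, h4⟩ := h L hL hA
  ⟨L', h1, h2, h3, by omega⟩

theorem mono_right (h : Reach c A B) (hD : D ⊆ B) : Reach c A D := fun L hL hA =>
  let ⟨L', h1, h2, h3, h4⟩ := h L hL hA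
  ⟨L', h1, h2, fun p hp => h3 p (hD hp), h4⟩

theorem self_union (h : Reach c A B) : Reach c A (A ∪ B) := by
  intro L hL hA
  obtain ⟨L', h1, h2, h3, h4⟩ := h L hL hA
  refine ⟨L', h1, h2, ?_, h4⟩
  rintro p (hp | hp)
  · exact h2 (hA p hp)
  · exact h3 p hp

theorem trans (h : Reach c A B) (h' : Reach d B D) : Reach (c + d) A D := by
  intro L hL hA
  obtain ⟨L', h1, h2, h3, h4⟩ := h L hL hA
  obtain ⟨L'', h1', h2', h3', h4'⟩ := h' L' h1 h3
  exact ⟨L'', h1', fun _ hp => h2' (h2 hp), h3', by omega⟩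

/-- Extensions keep `A` available, so the targets can be treated one after another and costs add. -/
theorem biUnion {J : Type*} (s : Finset J) {B : J → Set (MvPolynomial ι K)}
    (h : ∀ i ∈ s, Reach c A (B i)) : Reach (s.card * c) A (⋃ i ∈ s, B i) := by
  classical
  induction s using Finset.induction_on with
  | empty => simpa using of_subset (Set.empty_subset A)
  | insert i s hi ih =>
    intro L hL hA
    obtain ⟨L', h1, h2, h3, h4⟩ := ih (fun i hi => h i (Finset.mem_insert_of_mem hi)) L hL hA
    obtain ⟨L'', h1', h2', h3', h4'⟩ := h i (Finset.mem_insert_self i s) L' h1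
      fun p hp => h2 (hA p hp)
    refine ⟨L'', h1', fun _ hp => h2' (h2 hp), ?_, ?_⟩
    · intro p hp
      rw [Finset.set_biUnion_insert] at hp
      rcases hp with hp | hp
      · exact h3' p hp
      · exact h2' (h3 p hp)
    · rw [Finset.card_insert_of_notMem hi, add_mul]
      omega

theorem add_mul (h : Reach c A {q}) (w : K ⊕ ι) (hp : p ∈ A) :
    Reach (c + 2) A {q + atom w * p} := by
  intro L hL hA
  obtain ⟨L', h1, h2, h3, h4⟩ := h L hL hA
  have hp' : p ∈ L' := h2 (hA p hp)
  have hq' : q ∈ L' := h3 q rfl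
  refine ⟨_, .add (List.mem_cons_of_mem _ hq') List.mem_cons_self (.mul w hp' h1), ?_, ?_, ?_⟩
  · exact fun x hx => List.mem_cons_of_mem _ (List.mem_cons_of_mem _ (h2 hx))
  · rintro _ rfl
    exact List.mem_cons_self
  · simp only [List.length_cons]
    omega

theorem add_sum {J : Type*} (s : Finset J) (h : Reach c A {q}) (w : J → K ⊕ ι)
    {p : J → MvPolynomial ι K} (hp : ∀ i ∈ s, p i ∈ A) :
    Reach (c + 2 * s.card) A {q + ∑ i ∈ s, atom (w i) * p i} := by
  classical
  induction s using Finset.induction_on with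
  | empty => simpa using h
  | insert i s hi ih =>
    have := (ih fun i hi => hp i (Finset.mem_insert_of_mem hi)).add_mul (w i)
      (hp i (Finset.mem_insert_self i s))
    rw [Finset.sum_insert hi, Finset.card_insert_of_notMem hi, add_comm (atom _ * _), ← add_assoc]
    exact this

end Reach

end Reach

/-! ### Short skew programs for determinants -/

section Determinant

open MvPolynomial

variable {K : Type*} {ι : Type} [Field K] [CharP K 2] (w : ℕ → ℕ → K ⊕ ι) (N n : ℕ)

/-- The constants `0` and `1` and the coefficients up to degree `N` of `det (1 + X M)`, `M` being
the upper left `n × n` corner of the matrix of the atoms `w i j`. -/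
def detCoeffs : Set (MvPolynomial ι K) :=
  {0, 1} ∪ {p | ∃ d ≤ N, p = (revMatrix (fun i j => atom (w i j)) n).det.coeff d}

/-- The coefficients of degree less than `d` of the entries of `adj(1 + X M) v`, `v` being the upper
part of the `n`-th column. -/
def vecCoeffs (d : ℕ) : Set (MvPolynomial ι K) :=
  {p | ∃ e < d, ∃ i, p = (revVec (fun i j => atom (w i j)) n i).coeff e}

/-- By `revVec_eq`, a coefficient of degree `d` takes one product with a determinant coefficient and
`n` products with vector coefficients of degree `d - 1`. -/
theorem reach_vecCoeffs (d : ℕ) (hd : d ≤ N + 1) :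
    Reach (d * (n * (2 + 2 * n))) (detCoeffs w N n) (detCoeffs w N n ∪ vecCoeffs w n d) := by
  induction d with
  | zero =>
    rw [zero_mul]
    apply Reach.of_subset
    rintro p (hp | ⟨e, he, -⟩)
    · exact hp
    · omega
  | succ d ih =>
    have step : ∀ i : Fin n, Reach (2 + 2 * n) (detCoeffs w N n ∪ vecCoeffs w n d)
        {(revVec (fun i j => atom (w i j)) n i).coeff d} := by
      intro i
      -- The stored `0` is the initial value of the accumulated sum.
      have h0 : Reach 0 (detCoeffs w N n ∪ vecCoeffs w n d) {0} := by
        apply Reach.of_subset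
        rintro _ rfl
        exact Or.inl (Or.inl (Or.inl rfl))
      have h1 := h0.add_mul (w i n) (p := (revMatrix (fun i j => atom (w i j)) n).det.coeff d)
        (Or.inl (Or.inr ⟨d, by omega, rfl⟩))
      rw [revVec_eq]
      rcases d with _ | d
      · simpa using h1.mono (by omega)
      · have h2 := h1.add_sum Finset.univ (fun j : Fin n => w i j)
          (p := fun j => (revVec (fun i j => atom (w i j)) n j).coeff d)
          (fun j _ => Or.inr ⟨d, by omega, j, rfl⟩)
        rw [zero_add, zero_add, Finset.card_univ, Fintype.card_fin] at h2
        simpa [Polynomial.coeff_X_mul, Polynomial.finsetSum_coeff] using h2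
    have := (ih (by omega)).trans (Reach.biUnion Finset.univ fun i _ => step i).self_union
    rw [Finset.card_univ, Fintype.card_fin, ← Nat.succ_mul] at this
    refine this.mono_right ?_
    rintro p (hp | ⟨e, he, i, rfl⟩)
    · exact Or.inl (Or.inl hp)
    · rcases Nat.lt_succ_iff_lt_or_eq.1 he with he | rfl
      · exact Or.inl (Or.inr ⟨e, he, i, rfl⟩)
      · exact Or.inr (Set.mem_biUnion (Finset.mem_univ i) rfl)

theorem reach_detCoeffs_succ :
    Reach ((N + 1) * (n * (2 + 2 * n)) + (N + 1) * (2 + 2 * n)) (detCoeffs w N n)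
      (detCoeffs w N (n + 1)) := by
  refine (reach_vecCoeffs w N n (N + 1) le_rfl).trans ?_
  have step : ∀ d ∈ Finset.range (N + 1), Reach (2 + 2 * n)
      (detCoeffs w N n ∪ vecCoeffs w n (N + 1))
      {(revMatrix (fun i j => atom (w i j)) (n + 1)).det.coeff d} := by
    intro d hd
    rw [Finset.mem_range] at hd
    have h0 : Reach 0 (detCoeffs w N n ∪ vecCoeffs w n (N + 1))
        {(revMatrix (fun i j => atom (w i j)) n).det.coeff d} := by
      apply Reach.of_subset
      rintro _ rfl
      exact Or.inl (Or.inr ⟨d, by omega, rfl⟩)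
    rw [det_revMatrix_succ]
    -- The border term carries `X * X`, so it enters only from degree 2 on, through vector
    -- coefficients of degree two less.
    rcases d with _ | d
    · simpa using h0.mono (by omega)
    · have h1 := h0.add_mul (w n n) (p := (revMatrix (fun i j => atom (w i j)) n).det.coeff d)
        (Or.inl (Or.inr ⟨d, by omega, rfl⟩))
      rcases d with _ | d
      · simpa [Polynomial.coeff_X_mul] using h1.mono (by omega)
      · have h2 := h1.add_sum Finset.univ (fun j : Fin n => w n j)
          (p := fun j => (revVec (fun i j => atom (w i j)) n j).coeff d)
          (fun j _ => Or.inr ⟨d, by omega, j, rfl⟩)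
        rw [zero_add, Finset.card_univ, Fintype.card_fin] at h2
        simpa [Polynomial.coeff_X_mul, Polynomial.finsetSum_coeff] using h2
  have := (Reach.biUnion _ step).self_union
  rw [Finset.card_range] at this
  refine this.mono_right ?_
  rintro p (hp | ⟨d, hd, rfl⟩)
  · exact Or.inl (Or.inl (Or.inl hp))
  · exact Or.inr (Set.mem_biUnion (Finset.mem_coe.2 (Finset.mem_range.2 (Nat.lt_succ_of_le hd))) rfl)

theorem reach_detCoeffs (hn : n ≤ N) :
    Reach (n * (2 * (N + 1) ^ 3)) (detCoeffs w N 0) (detCoeffs w N n) := by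
  induction n with
  | zero => exact (Reach.of_subset subset_rfl).mono (Nat.zero_le _)
  | succ n ih =>
    refine ((ih (by omega)).trans (reach_detCoeffs_succ w N n)).mono ?_
    rw [Nat.succ_mul n]
    refine Nat.add_le_add_left ?_ _
    calc (N + 1) * (n * (2 + 2 * n)) + (N + 1) * (2 + 2 * n)
        = 2 * ((N + 1) * (n + 1) * (n + 1)) := by ring
      _ ≤ 2 * ((N + 1) * (N + 1) * (N + 1)) := by gcongr <;> omega
      _ ≤ 2 * (N + 1) ^ 3 := by rw [pow_three']

/-- In characteristic two, determinants of matrices of constants and variables have skew programs of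
polynomial length. -/
theorem exists_skewList_det : ∃ L, SkewList L ∧
    (of fun i j : Fin N => atom (w i j)).det ∈ L ∧ L.length ≤ 2 + N * (2 * (N + 1) ^ 3) := by
  -- The empty determinant is 1, so `0` and `1` are all the initial coefficients.
  have h0 : SkewList [(C (0 : K) : MvPolynomial ι K), C (1 : K)] := .const _ (.const _ .nil)
  obtain ⟨L, h1, -, h2, h3⟩ := reach_detCoeffs w N N le_rfl _ h0 (by
    rintro p ((rfl | rfl) | ⟨d, hd, rfl⟩)
    · simp
    · simp
    · have : (revMatrix (fun i j => atom (w i j)) 0).det = 1 := det_isEmpty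
      rw [this, Polynomial.coeff_one]
      split_ifs <;> simp)
  refine ⟨L, h1, ?_, h3⟩
  rw [← coeff_det_revMatrix (fun i j => (atom (w i j) : MvPolynomial ι K))]
  exact h2 _ (Or.inr ⟨N, le_rfl, rfl⟩)

end Determinant
end AlgComplexity

/-! ### Polynomial bounds and the conclusion -/

namespace AlgComplexity

namespace PBounded

variable {s t : ℕ → ℕ}

theorem mono (h : PBounded t) (hst : ∀ n, s n ≤ t n) : PBounded s :=
  let ⟨c, hc⟩ := h
  ⟨c, fun n => (hst n).trans (hc n)⟩

theorem const (c : ℕ) : PBounded fun _ => c := ⟨c, fun _ => Nat.le_add_left _ _⟩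

theorem add (hs : PBounded s) (ht : PBounded t) : PBounded fun n => s n + t n := by
  obtain ⟨a, ha⟩ := hs
  obtain ⟨b, hb⟩ := ht
  refine ⟨a + b + 2, fun n => (Nat.add_le_add (ha n) (hb n)).trans ?_⟩
  suffices n ^ a + n ^ b ≤ n ^ (a + b + 2) + 2 by omega
  rcases Nat.lt_or_ge n 2 with hn | hn
  · have h1 : n ^ a ≤ 1 := pow_le_one₀ (Nat.zero_le _) (by omega)
    have h2 : n ^ b ≤ 1 := pow_le_one₀ (Nat.zero_le _) (by omega)
    omega
  · have h1 : n ^ a ≤ n ^ (a + b + 1) := Nat.pow_le_pow_right (by omega) (by omega)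
    have h2 : n ^ b ≤ n ^ (a + b + 1) := Nat.pow_le_pow_right (by omega) (by omega)
    have h3 : n ^ (a + b + 1) * 2 ≤ n ^ (a + b + 1) * n := Nat.mul_le_mul_left _ hn
    rw [← pow_succ, show a + b + 1 + 1 = a + b + 2 from rfl] at h3
    omega

theorem mul (hs : PBounded s) (ht : PBounded t) : PBounded fun n => s n * t n := by
  obtain ⟨a, ha⟩ := hs
  obtain ⟨b, hb⟩ := ht
  -- As an addend the constant covers `n ≤ 1`. As an exponent it covers `n ≥ 2`, where `(1 + a) * (1
  -- + b)` is below `n` to that power.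
  refine ⟨a + b + (1 + a) * (1 + b), fun n => (Nat.mul_le_mul (ha n) (hb n)).trans ?_⟩
  rcases Nat.lt_or_ge n 2 with hn | hn
  · have h1 : n ^ a ≤ 1 := pow_le_one₀ (Nat.zero_le _) (by omega)
    have h2 : n ^ b ≤ 1 := pow_le_one₀ (Nat.zero_le _) (by omega)
    calc (n ^ a + a) * (n ^ b + b) ≤ (1 + a) * (1 + b) := by gcongr
      _ ≤ _ := by omega
  · have h1 : ∀ c, n ^ c + c ≤ n ^ c * (1 + c) := fun c => by
      have := Nat.mul_le_mul_right c (Nat.one_le_pow c n (by omega))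
      rw [mul_add]
      omega
    calc (n ^ a + a) * (n ^ b + b) ≤ n ^ a * (1 + a) * (n ^ b * (1 + b)) :=
          Nat.mul_le_mul (h1 a) (h1 b)
      _ = n ^ (a + b) * ((1 + a) * (1 + b)) := by ring
      _ ≤ n ^ (a + b) * n ^ ((1 + a) * (1 + b)) :=
          Nat.mul_le_mul_left _ (Nat.lt_pow_self (by omega)).le
      _ ≤ _ := by rw [← pow_add]; omega

theorem pow (ht : PBounded t) (m : ℕ) : PBounded fun n => t n ^ m := by
  induction m with
  | zero => exact const 1
  | succ m ih => exact ih.mul ht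

end PBounded

open MvPolynomial

variable {K : Type*} [Field K] [CharP K 2]

theorem exists_skewList_det_fintype {ι : Type} {m : Type*} [Fintype m] [DecidableEq m]
    (W : m → m → K ⊕ ι) : ∃ L, SkewList L ∧ (Matrix.of fun i j => atom (W i j)).det ∈ L ∧
      L.length ≤ 2 + Fintype.card m * (2 * (Fintype.card m + 1) ^ 3) := by
  let e := Fintype.equivFin m
  obtain ⟨L, h1, h2, h3⟩ := exists_skewList_det (fun i j =>
    if h : i < Fintype.card m ∧ j < Fintype.card m then W (e.symm ⟨i, h.1⟩) (e.symm ⟨j, h.2⟩)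
    else .inl 0) (Fintype.card m)
  refine ⟨L, h1, ?_, h3⟩
  convert h2 using 1
  rw [← Matrix.det_submatrix_equiv_self e.symm]
  congr 1
  ext1 i j
  simp

theorem map_partialPermanent {R S : Type*} [CommSemiring R] [CommSemiring S] (f : R →+* S) {n : ℕ}
    (A : Matrix (Fin n) (Fin n) R) : f (partialPermanent A) = partialPermanent (A.map f) := by
  unfold partialPermanent
  rw [map_sum]
  refine Finset.sum_congr rfl fun π _ => ?_
  rw [map_prod]
  refine Finset.prod_congr rfl fun i _ => ?_
  rcases π i <;> simp

/-- The square of a projection of the partial permanent has polynomial size skew programs. -/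
theorem exists_skewList_sq_of_isProjection {ι : Type} {f : MvPolynomial ι K} {t : ℕ}
    (h : IsProjection f ((partialPermanentFamily K).poly t)) : ∃ L, SkewList L ∧ f ^ 2 ∈ L ∧
      L.length ≤ 2 + (t + t) * (2 * (t + t + 1) ^ 3) := by
  obtain ⟨a, rfl⟩ := h
  -- The block matrix of `partialPermanent_sq` after the substitution `a`; its entries are still
  -- constants or variables.
  let W : Fin t ⊕ Fin t → Fin t ⊕ Fin t → K ⊕ ι := Matrix.fromBlocks
    (Matrix.of fun i j => .inl (if i = j then 1 else 0))
    (Matrix.of fun i j => a (finProdFinEquiv (i, j)))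
    (Matrix.of fun j i => a (finProdFinEquiv (i, j)))
    (Matrix.of fun i j => .inl (if i = j then 1 else 0))
  obtain ⟨L, h1, h2, h3⟩ := exists_skewList_det_fintype W
  refine ⟨L, h1, ?_, by simpa using h3⟩
  convert h2 using 1
  have := map_partialPermanent
    (MvPolynomial.aeval (R := K) fun j => (atom (a j) : MvPolynomial ι K)).toRingHom
    (Matrix.of fun i j : Fin t => X (finProdFinEquiv (i, j)))
  refine (congrArg (· ^ 2) this).trans ?_
  rw [partialPermanent_sq]
  congr 1
  ext1 i j
  rcases i with i | i <;> rcases j with j | j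
  · simp [W, atom, Matrix.one_apply, apply_ite C]
  · exact MvPolynomial.aeval_X _ _
  · exact MvPolynomial.aeval_X _ _
  · simp [W, atom, Matrix.one_apply, apply_ite C]

end AlgComplexity

theorem mainTheorem10 {k : Type*} [Field k] [CharP k 2]
    (h : AlgComplexity.IsVNPComplete (AlgComplexity.partialPermanentFamily k)) :
    AlgComplexity.VNPSq k ⊆ AlgComplexity.VPws k := by
  rintro _ ⟨f, hf, rfl⟩
  obtain ⟨t, ht, n₀, hproj⟩ := h.2 f hf
  obtain ⟨m, g, ⟨hm, -⟩, -⟩ := hf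
  choose L hL hmem using fun n => AlgComplexity.SkewList.exists_mem (f.poly n ^ 2)
  -- Bounds the program lengths for all `n < n₀`, where no projection is given.
  let c := ∑ n ∈ Finset.range n₀, (L n).length
  refine ⟨hm.mono fun n => Nat.le_add_right _ _,
    fun n => 2 * (2 + (t n + t n) * (2 * (t n + t n + 1) ^ 3) + c), ?_, fun n => ?_⟩
  · have ht2 := ht.add ht
    exact (AlgComplexity.PBounded.const 2).mul ((((AlgComplexity.PBounded.const 2).add
      (ht2.mul ((AlgComplexity.PBounded.const 2).mul
        ((ht2.add (AlgComplexity.PBounded.const 1)).pow 3)))).add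
      (AlgComplexity.PBounded.const c)))
  · have : ∃ L : List (MvPolynomial (Fin (f.numVars n)) k), AlgComplexity.SkewList L ∧
        f.poly n ^ 2 ∈ L ∧ L.length ≤ 2 + (t n + t n) * (2 * (t n + t n + 1) ^ 3) + c := by
      rcases Nat.lt_or_ge n n₀ with hn | hn
      · refine ⟨L n, hL n, hmem n, le_add_left ?_⟩
        exact Finset.single_le_sum (f := fun n => (L n).length) (fun _ _ => Nat.zero_le _)
          (Finset.mem_range.2 hn)
      · obtain ⟨L', h1, h2, h3⟩ :=
          AlgComplexity.exists_skewList_sq_of_isProjection (hproj n hn)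
        exact ⟨L', h1, h2, le_add_right h3⟩
    obtain ⟨L', h1, h2, h3⟩ := this
    obtain ⟨C, hC, hsize, hcomp⟩ := h1.exists_circuit h2
    exact ⟨C, hC, hsize.trans (Nat.mul_le_mul_left 2 h3), hcomp⟩
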